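/- Let $a > 0$ and let $\alpha$ be a finite measure on the Borel sets of $\mathbb{R}$ with $\alpha(\mathbb{R}) = a$, $\int_{\mathbb{R}} \log(1+|x|)\,\alpha(dx) < \infty$ and $\alpha\{x\} < a$ for every $x \in \mathbb{R}$. Let $\tilde\varphi$ be a Dirichlet process with parameter $\alpha$, that is, a random probability measure on $\mathbb{R}$ such that, for every finite measurable partition $C_1, \dots, C_{n+1}$ of $\mathbb{R}$, the random vector $(\tilde\varphi(C_1), \dots, \tilde\varphi(C_n))$ has the Dirichlet distribution with parameter $(\alpha(C_1), \dots, \alpha(C_{n+1}))$ (where a parameter equal to $0$ means that the corresponding component is $0$ almost surely). Then $\int |x|\,\tilde\varphi(dx) < \infty$ almost surely, and the probability distribution of the mean $\int x\,\tilde\varphi(dx)$ is absolutely continuous with respect to the Lebesgue measure on $\mathbb{R}$. -/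

import Mathlib

open MeasureTheory ProbabilityTheory

noncomputable section

namespace DirichletMean

/-- The open simplex `T_n` of all `u` in `ℝⁿ` with strictly positive coordinates of sum `< 1`. -/
def openSimplex (n : ℕ) : Set (Fin n → ℝ) := {u | (∀ i, 0 < u i) ∧ ∑ i, u i < 1}

/-- The Dirichlet density with parameter `(b_1, …, b_{n+1})`,
`Γ(b_1 + ⋯ + b_{n+1}) / (Γ(b_1) ⋯ Γ(b_{n+1})) · u_1^{b_1 - 1} ⋯ u_n^{b_n - 1} ·
(1 - u_1 - ⋯ - u_n)^{b_{n+1} - 1}`. It is used on `openSimplex n` only. -/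
def dirichletDensity {n : ℕ} (b : Fin (n + 1) → ℝ) (u : Fin n → ℝ) : ℝ :=
  Real.Gamma (∑ i, b i) / (∏ i, Real.Gamma (b i)) *
    (∏ i : Fin n, u i ^ (b i.castSucc - 1)) * (1 - ∑ i, u i) ^ (b (Fin.last n) - 1)

/-- The Dirichlet distribution on `ℝⁿ` with parameter `(b_1, …, b_{n+1})`, all `b_i > 0`. -/
def dirichletMeasure {n : ℕ} (b : Fin (n + 1) → ℝ) : Measure (Fin n → ℝ) :=
  (volume.restrict (openSimplex n)).withDensity fun u => ENNReal.ofReal (dirichletDensity b u)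

/-- The random probability measure `φ`, defined on the probability space `(Ω, P)`, is a Dirichlet
process with parameter the finite measure `α ≠ 0` on `ℝ`: for every finite measurable partition
`C_1, …, C_{n+1}` of `ℝ`, the vector `(φ(C_1), …, φ(C_n))` has the Dirichlet distribution with
parameter `(α(C_1), …, α(C_{n+1}))`. As usual, a parameter equal to `0` means that the
corresponding component is `0` almost surely; the cells of `α`-measure `0` are therefore dealt with
by `null`, and `law` concerns the partitions into cells of positive `α`-measure. -/
structure IsDirichletProcess (α : Measure ℝ) {Ω : Type*} [MeasurableSpace Ω] (P : Measure Ω)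
    (φ : Ω → ProbabilityMeasure ℝ) : Prop where
  measurable : Measurable φ
  null : ∀ C : Set ℝ, MeasurableSet C → α C = 0 → ∀ᵐ ω ∂P, φ ω C = 0
  law : ∀ (n : ℕ) (C : Fin (n + 1) → Set ℝ), (∀ i, MeasurableSet (C i)) →
    Pairwise (fun i j => Disjoint (C i) (C j)) → ⋃ i, C i = Set.univ → (∀ i, 0 < α (C i)) →
    P.map (fun ω (i : Fin n) => (φ ω (C i.castSucc) : ℝ)) = dirichletMeasure fun i => α.real (C i)

/-- The class `𝔽_a` of all measures `α` on `ℝ` of total mass `a` with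
`∫ log (1 + |x|) α(dx) < ∞`. -/
def classF (a : ℝ) : Set (Measure ℝ) :=
  {α | α Set.univ = ENNReal.ofReal a ∧ Integrable (fun x : ℝ => Real.log (1 + |x|)) α}

/-- The mean `φ(I) = ∫ x φ(dx)` of a probability measure on `ℝ`. -/
def mean (φ : ProbabilityMeasure ℝ) : ℝ := ∫ x, x ∂(φ : Measure ℝ)

/-- The mean is a measurable functional, so that the push-forward by `ω ↦ mean (φ ω)` is the
distribution of the mean (it is not the zero measure by convention). -/
theorem measurable_mean : Measurable mean := by
  let κ : Kernel (ProbabilityMeasure ℝ) ℝ := ⟨fun φ => (φ : Measure ℝ), measurable_subtype_coe⟩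
  have : IsMarkovKernel κ := ⟨fun φ => inferInstanceAs (IsProbabilityMeasure (φ : Measure ℝ))⟩
  exact (StronglyMeasurable.integral_kernel (κ := κ) (f := fun x : ℝ => x)
    stronglyMeasurable_id).measurable

end DirichletMean

end

/-! A Dirichlet vector is a vector of independent Gamma variables divided by its sum. Rescaling the
Gamma variables by positive factors `τ i` therefore changes the Dirichlet law into an explicitly
equivalent one (`lintegral_dirichletMeasure_tilt`). For the process, with `τ > 0` simple and `a =
α(ℝ)`, this reads E[f(φ(τg)/φ(τ)) φ(τ)^(-a)] = exp(-∫ log τ dα) · E[f(φ(g))], where `φ(h)` is the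
integral of `h` against `φ`.

Existence of the mean: take `f = 1` and let `τ` run through simple approximations of `1 + c|x|`. The
left side is asymptotically at most the probability that `∫ |x| dφ < ∞`, and the right side has a
lower bound tending to 1 as `c → 0`.

Absolute continuity: take `g = id`, `f` the indicator of a null set `N`, and `τ` equal to `s` left
of a threshold `t` and to 1 right of it. For each realization the tilted mean is a nondegenerate
Möbius function of `s`, so it avoids `N` for almost every `s`. By Tonelli the left side vanishes for
almost every `s > 0`, and the factor on the right is positive, so the mean avoids `N` almost surely.
-/

noncomputable section

namespace DirichletMean

open Set Filter Topology

/-! ### Gamma weights on the orthant and their projection to the simplex -/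

/-- The point of the closed simplex in `ℝⁿ⁺¹` whose first `n` coordinates are those of `u`. -/
def simplexPoint {n : ℕ} (u : Fin n → ℝ) : Fin (n + 1) → ℝ := Fin.snoc u (1 - ∑ i, u i)

@[simp] lemma simplexPoint_castSucc {n : ℕ} (u : Fin n → ℝ) (i : Fin n) :
    simplexPoint u i.castSucc = u i := by simp [simplexPoint]

@[simp] lemma simplexPoint_last {n : ℕ} (u : Fin n → ℝ) :
    simplexPoint u (Fin.last n) = 1 - ∑ i, u i := by simp [simplexPoint]

lemma sum_simplexPoint {n : ℕ} (u : Fin n → ℝ) : ∑ i, simplexPoint u i = 1 := by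
  simp [Fin.sum_univ_castSucc]

lemma measurable_simplexPoint {n : ℕ} : Measurable (simplexPoint (n := n)) := by
  refine measurable_pi_lambda _ fun i => ?_
  induction i using Fin.lastCases with
  | last => simp only [simplexPoint_last]; fun_prop
  | cast i => simp only [simplexPoint_castSucc]; fun_prop

lemma mem_openSimplex_iff {n : ℕ} {u : Fin n → ℝ} :
    u ∈ openSimplex n ↔ ∀ i, 0 < simplexPoint u i := by
  simp [openSimplex, Fin.forall_fin_succ', sub_pos]

lemma measurableSet_orthant (ι : Type*) [Fintype ι] :
    MeasurableSet {x : ι → ℝ | ∀ i, 0 < x i} := by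
  rw [ofPred_forall]
  exact MeasurableSet.iInter fun i => measurableSet_lt measurable_const (measurable_pi_apply i)

lemma measurableSet_openSimplex (n : ℕ) : MeasurableSet (openSimplex n) := by
  have h : openSimplex n = simplexPoint ⁻¹' {x | ∀ i, 0 < x i} := by
    ext u
    exact mem_openSimplex_iff
  rw [h]
  exact measurable_simplexPoint (measurableSet_orthant _)

/-- The weight `∏ x_i ^ (b_i - 1)` on the open positive orthant. -/
def orthantWeight {ι : Type*} [Fintype ι] (b : ι → ℝ) (x : ι → ℝ) : ENNReal :=
  {x : ι → ℝ | ∀ i, 0 < x i}.indicator (fun x => ENNReal.ofReal (∏ i, x i ^ (b i - 1))) x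

lemma measurable_orthantWeight {ι : Type*} [Fintype ι] (b : ι → ℝ) :
    Measurable (orthantWeight b) := by
  exact Measurable.indicator (by fun_prop) (measurableSet_orthant ι)

/-- Positive scalings preserve the orthant and its complement, so the identity also holds where the
weight vanishes. -/
lemma orthantWeight_mul {ι : Type*} [Fintype ι] (b : ι → ℝ) {τ : ι → ℝ} (hτ : ∀ i, 0 < τ i)
    (x : ι → ℝ) : orthantWeight b (τ * x) =
      ENNReal.ofReal (∏ i, τ i ^ (b i - 1)) * orthantWeight b x := by
  unfold orthantWeight
  by_cases hx : ∀ i, 0 < x i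
  · rw [indicator_of_mem (by simpa using fun i => mul_pos (hτ i) (hx i)),
      indicator_of_mem (by simpa using hx),
      ← ENNReal.ofReal_mul (Finset.prod_nonneg fun i _ => Real.rpow_nonneg (hτ i).le _),
      ← Finset.prod_mul_distrib]
    congr 1
    exact Finset.prod_congr rfl fun i _ => Real.mul_rpow (hτ i).le (hx i).le
  · rw [indicator_of_notMem (by simpa [mul_pos_iff_of_pos_left, hτ] using hx),
      indicator_of_notMem (by simpa using hx), mul_zero]

/-- Coordinatewise scaling in the Lebesgue integral over `ℝ^ι`. -/
lemma lintegral_comp_coordinate_mul {ι : Type*} [Fintype ι] {τ : ι → ℝ} (hτ : ∀ i, 0 < τ i)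
    {H : (ι → ℝ) → ENNReal} (hH : Measurable H) :
    ∫⁻ x, H x = ENNReal.ofReal (∏ i, τ i) * ∫⁻ x, H (τ * x) := by
  classical
  have hd : (Matrix.diagonal τ).det = ∏ i, τ i := Matrix.det_diagonal
  have hp : 0 < ∏ i, τ i := Finset.prod_pos fun i _ => hτ i
  conv_lhs => rw [← Real.smul_map_diagonal_volume_pi (D := τ) (by rw [hd]; exact hp.ne')]
  rw [lintegral_smul_measure, hd, abs_of_pos hp,
    lintegral_map hH (LinearMap.continuous_of_finiteDimensional _).measurable, smul_eq_mul]
  congr 2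
  ext x
  congr 1
  ext i
  simp [Matrix.mulVec_diagonal]

/-- Integration over the half space `∑ x_i > 0` of `ℝⁿ⁺¹` in terms of the sum `s` of the
coordinates and the point `s⁻¹ x` of the hyperplane `∑ x_i = 1`. -/
lemma lintegral_eq_lintegral_smul_simplexPoint {n : ℕ} {H : (Fin (n + 1) → ℝ) → ENNReal}
    (hH : Measurable H) (h0 : ∀ x, ∑ i, x i ≤ 0 → H x = 0) :
    ∫⁻ x, H x = ∫⁻ s in Ioi (0 : ℝ), ENNReal.ofReal (s ^ n) *
      ∫⁻ u : Fin n → ℝ, H (s • simplexPoint u) := by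
  have hm : Measurable fun q : ℝ × (Fin n → ℝ) =>
      H (Fin.snoc (α := fun _ => ℝ) q.2 (q.1 - ∑ i, q.2 i)) := by
    refine hH.comp (measurable_pi_lambda _ fun i => ?_)
    induction i using Fin.lastCases with
    | last => simp only [Fin.snoc_last]; fun_prop
    | cast i => simp only [Fin.snoc_castSucc]; fun_prop
  have hm' : Measurable fun q : ℝ × (Fin n → ℝ) => H (Fin.snoc (α := fun _ => ℝ) q.2 q.1) := by
    refine hH.comp (measurable_pi_lambda _ fun i => ?_)
    induction i using Fin.lastCases with
    | last => simp only [Fin.snoc_last]; fun_prop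
    | cast i => simp only [Fin.snoc_castSucc]; fun_prop
  calc ∫⁻ x, H x
      = ∫⁻ q : ℝ × (Fin n → ℝ), H (Fin.snoc (α := fun _ => ℝ) q.2 q.1) := by
        rw [← (volume_preserving_piFinSuccAbove (fun _ : Fin (n + 1) => ℝ)
          (Fin.last n)).lintegral_comp hm']
        congr 1
        ext x
        congr 1
        ext i
        induction i using Fin.lastCases with
        | last => simp [MeasurableEquiv.piFinSuccAbove, Fin.insertNthEquiv]
        | cast i => simp [MeasurableEquiv.piFinSuccAbove, Fin.insertNthEquiv, Fin.init]
    _ = ∫⁻ u : Fin n → ℝ, ∫⁻ t : ℝ, H (Fin.snoc (α := fun _ => ℝ) u t) :=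
        lintegral_prod_symm _ hm'.aemeasurable
    _ = ∫⁻ u : Fin n → ℝ, ∫⁻ s : ℝ, H (Fin.snoc (α := fun _ => ℝ) u (s - ∑ i, u i)) := by
        congr 1
        ext u
        exact (lintegral_sub_right_eq_self
          (fun t => H (Fin.snoc (α := fun _ => ℝ) u t)) (∑ i, u i)).symm
    _ = ∫⁻ s : ℝ, ∫⁻ u : Fin n → ℝ, H (Fin.snoc (α := fun _ => ℝ) u (s - ∑ i, u i)) :=
        (lintegral_lintegral_swap hm.aemeasurable).symm
    _ = ∫⁻ s in Ioi (0 : ℝ), ∫⁻ u : Fin n → ℝ,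
          H (Fin.snoc (α := fun _ => ℝ) u (s - ∑ i, u i)) := by
        rw [← lintegral_indicator measurableSet_Ioi]
        congr 1
        ext s
        by_cases hs : 0 < s
        · simp [hs]
        · rw [indicator_of_notMem (by simpa using hs)]
          refine lintegral_eq_zero_of_ae_eq_zero (Filter.Eventually.of_forall fun u => h0 _ ?_)
          simpa [Fin.sum_univ_castSucc] using hs
    _ = _ := by
        refine setLIntegral_congr_fun measurableSet_Ioi fun s hs => ?_
        have hs : 0 < s := hs
        -- Substituting `s u` for `u` produces the factor `s ^ n` and makes the point a multiple of
        -- `simplexPoint u`.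
        rw [lintegral_comp_coordinate_mul (τ := fun _ => s) (fun _ => hs)
          (H := fun u => H (Fin.snoc (α := fun _ => ℝ) u (s - ∑ i, u i)))
          (hm.comp measurable_prodMk_left)]
        simp only [Finset.prod_const, Finset.card_univ, Fintype.card_fin]
        congr 2
        ext u
        congr 1
        ext i
        induction i using Fin.lastCases with
        | last => simp [← Finset.mul_sum, mul_sub]
        | cast i => simp

lemma lintegral_rpow_mul_exp_neg {β c : ℝ} (hβ : 0 < β) (hc : 0 < c) :
    ∫⁻ s in Ioi (0 : ℝ), ENNReal.ofReal (s ^ (β - 1) * Real.exp (-(c * s))) =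
      ENNReal.ofReal (Real.Gamma β) * ENNReal.ofReal (c ^ (-β)) := by
  have hi := Real.integral_rpow_mul_exp_neg_mul_Ioi hβ hc
  have hint : IntegrableOn (fun t : ℝ => t ^ (β - 1) * Real.exp (-(c * t))) (Ioi 0) := by
    -- A non-integrable function would have Bochner integral 0, but the closed form is positive.
    by_contra h
    rw [integral_undef h] at hi
    have := mul_pos (Real.rpow_pos_of_pos (one_div_pos.2 hc) β) (Real.Gamma_pos_of_pos hβ)
    exact this.ne hi
  rw [← ofReal_integral_eq_lintegral_ofReal hint, hi, ← ENNReal.ofReal_mul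
    (Real.Gamma_pos_of_pos hβ).le, mul_comm, one_div, Real.inv_rpow hc.le, Real.rpow_neg hc.le]
  filter_upwards [ae_restrict_mem measurableSet_Ioi] with s hs
  have hs : 0 < s := hs
  positivity

/-- Integrating out the radial coordinate. -/
lemma lintegral_mul_exp_neg_mul_orthantWeight {n : ℕ} {b : Fin (n + 1) → ℝ} (hb : ∀ i, 0 < b i)
    {τ : Fin (n + 1) → ℝ} (hτ : ∀ i, 0 < τ i) {F : (Fin (n + 1) → ℝ) → ENNReal}
    (hF : Measurable F) (hom : ∀ s : ℝ, 0 < s → ∀ x, F (s • x) = F x) :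
    ∫⁻ x, F x * ENNReal.ofReal (Real.exp (-∑ i, τ i * x i)) * orthantWeight b x =
      ENNReal.ofReal (Real.Gamma (∑ i, b i)) *
        ∫⁻ u : Fin n → ℝ, F (simplexPoint u) *
          ENNReal.ofReal ((∑ i, τ i * simplexPoint u i) ^ (-∑ i, b i)) *
          orthantWeight b (simplexPoint u) := by
  have hW := measurable_orthantWeight b
  have hP := measurable_simplexPoint (n := n)
  have hPi : ∀ i, Measurable fun u : Fin n → ℝ => simplexPoint u i :=
    fun i => (measurable_pi_apply i).comp hP
  have hβ : 0 < ∑ i, b i := Finset.sum_pos (fun i _ => hb i) Finset.univ_nonempty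
  rw [lintegral_eq_lintegral_smul_simplexPoint (by fun_prop)]
  swap
  · intro x hx
    have : ¬ ∀ i, 0 < x i := fun h => absurd hx
      (not_le.2 (Finset.sum_pos (fun i _ => h i) Finset.univ_nonempty))
    rw [orthantWeight, indicator_of_notMem (by simpa using this), mul_zero]
  have key : ∀ s ∈ Ioi (0 : ℝ), ENNReal.ofReal (s ^ n) * ∫⁻ u : Fin n → ℝ,
      F (s • simplexPoint u) *
        ENNReal.ofReal (Real.exp (-∑ i, τ i * (s • simplexPoint u) i)) *
        orthantWeight b (s • simplexPoint u) =
      ∫⁻ u : Fin n → ℝ, F (simplexPoint u) * orthantWeight b (simplexPoint u) *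
        ENNReal.ofReal (s ^ (∑ i, b i - 1) *
          Real.exp (-((∑ i, τ i * simplexPoint u i) * s))) := by
    intro s hs
    have hs : 0 < s := hs
    rw [← lintegral_const_mul' _ _ ENNReal.ofReal_ne_top]
    congr 1
    ext u
    have e1 : s • simplexPoint u = (fun _ => s) * simplexPoint u := rfl
    -- The weight has `n + 1` factors and the Jacobian contributes `n`, hence the exponent `∑ b i -
    -- 1`.
    have e2 : s ^ (∑ i, b i - 1) = s ^ n * ∏ i, s ^ (b i - 1) := by
      rw [← Real.rpow_sum_of_pos hs, ← Real.rpow_natCast, ← Real.rpow_add hs]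
      congr 1
      simp
      ring
    have e3 : ∑ i, τ i * (s • simplexPoint u) i = (∑ i, τ i * simplexPoint u i) * s := by
      rw [Finset.sum_mul]
      exact Finset.sum_congr rfl fun i _ => by simp; ring
    rw [hom s hs, e3, e1, orthantWeight_mul b fun _ => hs, e2,
      ENNReal.ofReal_mul (by positivity), ENNReal.ofReal_mul (by positivity)]
    ring
  rw [setLIntegral_congr_fun measurableSet_Ioi key, lintegral_lintegral_swap,
    ← lintegral_const_mul' _ _ ENNReal.ofReal_ne_top]
  · congr 1
    ext u
    rw [lintegral_const_mul _ (by fun_prop)]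
    by_cases hu : ∀ i, 0 < simplexPoint u i
    · rw [lintegral_rpow_mul_exp_neg hβ
        (Finset.sum_pos (fun i _ => mul_pos (hτ i) (hu i)) Finset.univ_nonempty)]
      ring
    · rw [orthantWeight, indicator_of_notMem (by simpa using hu)]
      simp
  · have h2 : Measurable fun q : ℝ × (Fin n → ℝ) => simplexPoint q.2 := hP.comp measurable_snd
    have h2i : ∀ i, Measurable fun q : ℝ × (Fin n → ℝ) => simplexPoint q.2 i :=
      fun i => (hPi i).comp measurable_snd
    refine Measurable.aemeasurable ?_
    simp only [Function.uncurry_def]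
    fun_prop

/-- Expresses the Dirichlet law through the homogeneous weight on `ℝⁿ⁺¹`, so that orthant identities
apply to it. -/
lemma lintegral_dirichletMeasure {n : ℕ} {b : Fin (n + 1) → ℝ} (hb : ∀ i, 0 < b i)
    {F : (Fin n → ℝ) → ENNReal} (hF : Measurable F) :
    ∫⁻ u, F u ∂dirichletMeasure b =
      ENNReal.ofReal (Real.Gamma (∑ i, b i) / ∏ i, Real.Gamma (b i)) *
        ∫⁻ u : Fin n → ℝ, F u * orthantWeight b (simplexPoint u) := by
  have hd : Measurable fun u : Fin n → ℝ => ENNReal.ofReal (dirichletDensity b u) := by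
    unfold dirichletDensity
    fun_prop
  rw [dirichletMeasure, lintegral_withDensity_eq_lintegral_mul _ hd hF,
    ← lintegral_indicator (measurableSet_openSimplex n),
    ← lintegral_const_mul' _ _ ENNReal.ofReal_ne_top]
  congr 1
  ext u
  have hC : 0 ≤ Real.Gamma (∑ i, b i) / ∏ i, Real.Gamma (b i) := by
    refine div_nonneg (Real.Gamma_nonneg_of_nonneg (Finset.sum_nonneg fun i _ => (hb i).le))
      (Finset.prod_nonneg fun i _ => (Real.Gamma_pos_of_pos (hb i)).le)
  by_cases hu : u ∈ openSimplex n
  · rw [indicator_of_mem hu, orthantWeight,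
      indicator_of_mem (by simpa using mem_openSimplex_iff.1 hu), Pi.mul_apply,
      dirichletDensity, mul_assoc, ENNReal.ofReal_mul hC]
    simp only [Fin.prod_univ_castSucc (n := n), simplexPoint_castSucc, simplexPoint_last]
    ring
  · rw [indicator_of_notMem hu, orthantWeight,
      indicator_of_notMem (by simpa using fun h => hu (mem_openSimplex_iff.2 h)), mul_zero, mul_zero]

/-- The Dirichlet distribution is quasi-invariant under the projective action of positive diagonal
matrices. -/
lemma lintegral_dirichletMeasure_tilt {n : ℕ} {b : Fin (n + 1) → ℝ} (hb : ∀ i, 0 < b i)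
    {τ : Fin (n + 1) → ℝ} (hτ : ∀ i, 0 < τ i) {F : (Fin (n + 1) → ℝ) → ENNReal}
    (hF : Measurable F) :
    ∫⁻ u, F ((∑ i, τ i * simplexPoint u i)⁻¹ • (τ * simplexPoint u)) *
        ENNReal.ofReal ((∑ i, τ i * simplexPoint u i) ^ (-∑ i, b i)) ∂dirichletMeasure b =
      ENNReal.ofReal (∏ i, τ i ^ (-b i)) * ∫⁻ u, F (simplexPoint u) ∂dirichletMeasure b := by
  have hW := measurable_orthantWeight b
  have hP := measurable_simplexPoint (n := n)
  have hPi : ∀ i, Measurable fun u : Fin n → ℝ => simplexPoint u i :=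
    fun i => (measurable_pi_apply i).comp hP
  have hβ : 0 < ∑ i, b i := Finset.sum_pos (fun i _ => hb i) Finset.univ_nonempty
  have hG : ENNReal.ofReal (Real.Gamma (∑ i, b i)) ≠ 0 := by
    simpa using Real.Gamma_pos_of_pos hβ
  have hS : ∀ σ : Fin (n + 1) → ℝ, Measurable fun x : Fin (n + 1) → ℝ =>
      F ((∑ i, σ i * x i)⁻¹ • (σ * x)) := fun σ => hF.comp (by fun_prop)
  have hhom : ∀ σ : Fin (n + 1) → ℝ, ∀ s : ℝ, 0 < s → ∀ x : Fin (n + 1) → ℝ,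
      F ((∑ i, σ i * (s • x) i)⁻¹ • (σ * (s • x))) = F ((∑ i, σ i * x i)⁻¹ • (σ * x)) := by
    intro σ s hs x
    have e3 : ∑ i, σ i * (s • x) i = (∑ i, σ i * x i) * s := by
      rw [Finset.sum_mul]
      exact Finset.sum_congr rfl fun i _ => by simp; ring
    rw [e3, mul_smul_comm, smul_smul, mul_inv, mul_assoc, inv_mul_cancel₀ hs.ne', mul_one]
  -- One orthant integral is evaluated in two ways: directly with all rates 1, and with rates `τ`
  -- after the substitution of `τ * x` for `x`.
  have h1 := lintegral_mul_exp_neg_mul_orthantWeight hb (τ := 1) (fun _ => one_pos) (hS 1) (hhom 1)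
  have h2 := lintegral_mul_exp_neg_mul_orthantWeight hb hτ (hS τ) (hhom τ)
  rw [lintegral_comp_coordinate_mul hτ (by have := hS 1; fun_prop)] at h1
  simp only [Pi.one_apply, one_mul, orthantWeight_mul b hτ, sum_simplexPoint, Real.one_rpow,
    ENNReal.ofReal_one, mul_one, inv_one, one_smul, Pi.mul_apply] at h1
  have h3 : ∀ x : Fin (n + 1) → ℝ, F ((∑ i, τ i * x i)⁻¹ • (τ * x)) *
      ENNReal.ofReal (Real.exp (-∑ i, τ i * x i)) *
      (ENNReal.ofReal (∏ i, τ i ^ (b i - 1)) * orthantWeight b x) =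
      ENNReal.ofReal (∏ i, τ i ^ (b i - 1)) * (F ((∑ i, τ i * x i)⁻¹ • (τ * x)) *
      ENNReal.ofReal (Real.exp (-∑ i, τ i * x i)) * orthantWeight b x) := fun x => by ring
  simp only [h3] at h1
  rw [lintegral_const_mul' _ _ ENNReal.ofReal_ne_top, h2, ← mul_assoc,
    ← ENNReal.ofReal_mul (Finset.prod_nonneg fun i _ => (hτ i).le),
    ← Finset.prod_mul_distrib, mul_left_comm,
    ENNReal.mul_right_inj hG ENNReal.ofReal_ne_top] at h1
  have h4 : ∀ i, τ i * τ i ^ (b i - 1) = τ i ^ b i := fun i => by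
    rw [Real.rpow_sub_one (hτ i).ne']
    field_simp [(hτ i).ne']
  simp only [h4] at h1
  have h6 := (hS τ).comp hP
  simp only [Function.comp_def] at h6
  rw [lintegral_dirichletMeasure hb (by fun_prop),
    lintegral_dirichletMeasure hb (F := fun u => F (simplexPoint u)) (hF.comp hP), ← h1, mul_left_comm,
    ← mul_assoc (ENNReal.ofReal (∏ i, τ i ^ (-b i))), ← ENNReal.ofReal_mul
    (Finset.prod_nonneg fun i _ => Real.rpow_nonneg (hτ i).le _), ← Finset.prod_mul_distrib]
  have h5 : ∀ i, τ i ^ (-b i) * τ i ^ b i = 1 := fun i => by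
    rw [← Real.rpow_add (hτ i)]
    simp
  simp [h5]

/-! ### Finite-dimensional laws of the process -/

lemma measurable_integral {h : ℝ → ℝ} (hh : Measurable h) :
    Measurable fun φ : ProbabilityMeasure ℝ => ∫ x, h x ∂(φ : Measure ℝ) := by
  let κ : Kernel (ProbabilityMeasure ℝ) ℝ := ⟨fun φ => (φ : Measure ℝ), measurable_subtype_coe⟩
  have : IsMarkovKernel κ := ⟨fun φ => inferInstanceAs (IsProbabilityMeasure (φ : Measure ℝ))⟩
  exact (StronglyMeasurable.integral_kernel (κ := κ) (f := h) hh.stronglyMeasurable).measurable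

lemma measurable_measureReal {C : Set ℝ} (hC : MeasurableSet C) :
    Measurable fun φ : ProbabilityMeasure ℝ => (φ : Measure ℝ).real C :=
  ((Measure.measurable_coe hC).comp measurable_subtype_coe).ennreal_toReal

variable {α : Measure ℝ} {Ω : Type*} [MeasurableSpace Ω] {P : Measure Ω}
  {φ : Ω → ProbabilityMeasure ℝ}

/-- Almost sure statements for `α` hold almost surely for almost all realizations of the process. -/
lemma IsDirichletProcess.ae_ae (hφ : IsDirichletProcess α P φ) {p : ℝ → Prop}
    (hp : ∀ᵐ x ∂α, p x) : ∀ᵐ ω ∂P, ∀ᵐ x ∂(φ ω : Measure ℝ), p x := by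
  filter_upwards [hφ.null (toMeasurable α {x | ¬ p x}) (measurableSet_toMeasurable _ _)
    ((measure_toMeasurable _).trans hp)] with ω hω
  refine measure_mono_null (subset_toMeasurable α {x | ¬ p x}) ?_
  simpa using hω

lemma simplexPoint_measureReal (μ : Measure ℝ) [IsProbabilityMeasure μ] {n : ℕ}
    {c : ℝ → Fin (n + 1)} (hc : Measurable c) :
    simplexPoint (fun i : Fin n => μ.real (c ⁻¹' {i.castSucc})) =
      fun i => μ.real (c ⁻¹' {i}) := by
  have hs : ∑ i, μ.real (c ⁻¹' {i}) = 1 := by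
    rw [sum_measureReal_preimage_singleton _ fun i _ => hc (measurableSet_singleton i)]
    simp
  ext i
  induction i using Fin.lastCases with
  | last =>
    rw [Fin.sum_univ_castSucc] at hs
    simp only [simplexPoint_last]
    linarith
  | cast i => simp

lemma IsDirichletProcess.map_eq (hφ : IsDirichletProcess α P φ) {n : ℕ}
    {c : ℝ → Fin (n + 1)} (hc : Measurable c) (hpos : ∀ i, 0 < α (c ⁻¹' {i})) :
    P.map (fun ω (i : Fin n) => (φ ω : Measure ℝ).real (c ⁻¹' {i.castSucc})) =
      dirichletMeasure fun i => α.real (c ⁻¹' {i}) := by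
  refine hφ.law n (fun i => c ⁻¹' {i}) (fun i => hc (measurableSet_singleton i)) ?_ ?_ hpos
  · exact fun i j hij => Disjoint.preimage c (by simpa using hij)
  · ext x
    simp

lemma IsDirichletProcess.lintegral_eq (hφ : IsDirichletProcess α P φ) {n : ℕ}
    {c : ℝ → Fin (n + 1)} (hc : Measurable c) (hpos : ∀ i, 0 < α (c ⁻¹' {i}))
    {F : (Fin (n + 1) → ℝ) → ENNReal} (hF : Measurable F) :
    ∫⁻ ω, F (fun i => (φ ω : Measure ℝ).real (c ⁻¹' {i})) ∂P =
      ∫⁻ u, F (simplexPoint u) ∂dirichletMeasure fun i => α.real (c ⁻¹' {i}) := by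
  have hm : Measurable fun ω (i : Fin n) => (φ ω : Measure ℝ).real (c ⁻¹' {i.castSucc}) :=
    measurable_pi_lambda _ fun i =>
      (measurable_measureReal (hc (measurableSet_singleton _))).comp hφ.measurable
  rw [← hφ.map_eq hc hpos, lintegral_map (f := fun u => F (simplexPoint u))
    (hF.comp measurable_simplexPoint) hm]
  simp only [simplexPoint_measureReal _ hc]

/-- The Dirichlet law is carried by the open simplex. This positivity later makes the Möbius
transformation nondegenerate. -/
lemma IsDirichletProcess.ae_pos (hφ : IsDirichletProcess α P φ) {n : ℕ}
    {c : ℝ → Fin (n + 1)} (hc : Measurable c) (hpos : ∀ i, 0 < α (c ⁻¹' {i})) :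
    ∀ᵐ ω ∂P, ∀ i, 0 < (φ ω : Measure ℝ).real (c ⁻¹' {i}) := by
  have hm : Measurable fun ω (i : Fin n) => (φ ω : Measure ℝ).real (c ⁻¹' {i.castSucc}) :=
    measurable_pi_lambda _ fun i =>
      (measurable_measureReal (hc (measurableSet_singleton _))).comp hφ.measurable
  have h : ∀ᵐ u ∂dirichletMeasure fun i => α.real (c ⁻¹' {i}), u ∈ openSimplex n :=
    (withDensity_absolutelyContinuous _ _).ae_le (ae_restrict_mem (measurableSet_openSimplex n))
  rw [← hφ.map_eq hc hpos] at h
  filter_upwards [ae_of_ae_map hm.aemeasurable h] with ω hω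
  rw [mem_openSimplex_iff, simplexPoint_measureReal _ hc] at hω
  exact hω

/-- A simple function is almost everywhere a function of a finite measurable partition into cells
of positive measure. -/
lemma exists_index_ae_eq {β : Type*} (hα : α ≠ 0) (q : SimpleFunc ℝ β) :
    ∃ (n : ℕ) (c : ℝ → Fin (n + 1)) (r : Fin (n + 1) → β), Measurable c ∧
      (∀ i, 0 < α (c ⁻¹' {i})) ∧ (∀ i, r i ∈ Set.range q) ∧ ∀ᵐ x ∂α, q x = r (c x) := by
  classical
  -- Values taken on `α`-null sets are dropped, since `law` only treats cells of positive mass.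
  let S := q.range.filter fun y => α (q ⁻¹' {y}) ≠ 0
  have hS : ∀ᵐ x ∂α, q x ∈ S := by
    have h : ∀ y ∈ q.range.filter (fun y => α (q ⁻¹' {y}) = 0), ∀ᵐ x ∂α, q x ≠ y := fun y hy => by
      rw [ae_iff]
      refine (congrArg α ?_).trans (Finset.mem_filter.1 hy).2
      ext x
      simp
    filter_upwards [(Finset.eventually_all _).2 h] with x hx
    by_contra hxS
    simp only [S, Finset.mem_filter, SimpleFunc.mem_range_self, true_and, not_not] at hxS
    exact hx (q x) (Finset.mem_filter.2 ⟨SimpleFunc.mem_range_self q x, hxS⟩) rfl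
  have : NeZero α := ⟨hα⟩
  obtain ⟨x₀, hx₀⟩ := hS.exists
  obtain ⟨n, hn⟩ : ∃ n, S.card = n + 1 :=
    Nat.exists_eq_succ_of_ne_zero (Finset.card_ne_zero_of_mem hx₀)
  let e : S ≃ Fin (n + 1) := S.equivFin.trans (finCongr hn)
  -- Points with a dropped value join the last cell, so that the cells still cover all of `ℝ`.
  let k : β → Fin (n + 1) := fun y => if h : y ∈ S then e ⟨y, h⟩ else Fin.last n
  have hk : ∀ i, k (e.symm i) = i := fun i => by simp [k]
  refine ⟨n, q.map k, fun i => e.symm i, (q.map k).measurable, fun i => ?_, fun i => ?_, ?_⟩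
  · have h1 := (Finset.mem_filter.1 (e.symm i).2).2
    refine (pos_iff_ne_zero.2 h1).trans_le (measure_mono fun x hx => ?_)
    have hx : q x = e.symm i := hx
    simp [hx, hk]
  · exact SimpleFunc.mem_range.1 (Finset.mem_filter.1 (e.symm i).2).1
  · filter_upwards [hS] with x hx
    simp [k, hx]

lemma integral_comp_index (μ : Measure ℝ) [IsFiniteMeasure μ] {n : ℕ} {c : ℝ → Fin (n + 1)}
    (hc : Measurable c) (h : Fin (n + 1) → ℝ) :
    ∫ x, h (c x) ∂μ = ∑ i, h i * μ.real (c ⁻¹' {i}) := by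
  rw [← integral_map hc.aemeasurable (f := h) (by fun_prop),
    integral_fintype (Integrable.of_finite)]
  refine Finset.sum_congr rfl fun i _ => ?_
  rw [map_measureReal_apply hc (measurableSet_singleton i), smul_eq_mul, mul_comm]

/-! ### Tilting by simple functions -/

/-- Tilting a Dirichlet process by a positive simple function. -/
lemma IsDirichletProcess.lintegral_tilt_simple (hφ : IsDirichletProcess α P φ)
    [IsFiniteMeasure α] (hα : α ≠ 0) (g τ : SimpleFunc ℝ ℝ) (hτ : ∀ x, 0 < τ x)
    {f : ℝ → ENNReal} (hf : Measurable f) :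
    ∫⁻ ω, f ((∫ x, τ x ∂(φ ω : Measure ℝ))⁻¹ * ∫ x, τ x * g x ∂(φ ω : Measure ℝ)) *
        ENNReal.ofReal ((∫ x, τ x ∂(φ ω : Measure ℝ)) ^ (-α.real univ)) ∂P =
      ENNReal.ofReal (Real.exp (-∫ x, Real.log (τ x) ∂α)) *
        ∫⁻ ω, f (∫ x, g x ∂(φ ω : Measure ℝ)) ∂P := by
  obtain ⟨n, c, r, hc, hpos, hr, hae⟩ := exists_index_ae_eq hα (g.pair τ)
  have hr2 : ∀ i, 0 < (r i).2 := fun i => by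
    obtain ⟨x, hx⟩ := hr i
    rw [← hx]
    exact hτ x
  -- Used both for `α` and for the realizations `φ ω`, which inherit the almost everywhere identity
  -- by `ae_ae`.
  have hI : ∀ (μ : Measure ℝ) [IsFiniteMeasure μ], (∀ᵐ x ∂μ, g.pair τ x = r (c x)) →
      ∀ h : ℝ × ℝ → ℝ, ∫ x, h (g x, τ x) ∂μ = ∑ i, h (r i) * μ.real (c ⁻¹' {i}) := by
    intro μ _ hμ h
    rw [← integral_comp_index μ hc fun i => h (r i)]
    refine integral_congr_ae ?_
    filter_upwards [hμ] with x hx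
    rw [← hx]
    rfl
  have hsum : α.real univ = ∑ i, α.real (c ⁻¹' {i}) := by
    rw [sum_measureReal_preimage_singleton _ fun i _ => hc (measurableSet_singleton i)]
    simp
  have hprod : Real.exp (-∫ x, Real.log (τ x) ∂α) = ∏ i, (r i).2 ^ (-α.real (c ⁻¹' {i})) := by
    rw [hI α hae fun y => Real.log y.2, ← Finset.sum_neg_distrib, Real.exp_sum]
    refine Finset.prod_congr rfl fun i _ => ?_
    rw [Real.rpow_def_of_pos (hr2 i), mul_neg]
  let F : (Fin (n + 1) → ℝ) → ENNReal := fun p => f (∑ i, (r i).1 * p i)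
  have hF : Measurable F := hf.comp (by fun_prop)
  have key := lintegral_dirichletMeasure_tilt (b := fun i => α.real (c ⁻¹' {i}))
    (fun i => ENNReal.toReal_pos (hpos i).ne' (measure_ne_top _ _)) hr2 hF
  rw [← hφ.lintegral_eq hc hpos hF, ← hφ.lintegral_eq hc hpos (F := fun p =>
    F ((∑ i, (r i).2 * p i)⁻¹ • ((fun i => (r i).2) * p)) *
      ENNReal.ofReal ((∑ i, (r i).2 * p i) ^ (-∑ i, α.real (c ⁻¹' {i}))))
    (by have : Measurable fun p : Fin (n + 1) → ℝ =>
          F ((∑ i, (r i).2 * p i)⁻¹ • ((fun i => (r i).2) * p)) := hF.comp (by fun_prop)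
        fun_prop)] at key
  rw [hprod, hsum]
  convert key using 1
  · refine lintegral_congr_ae ?_
    filter_upwards [hφ.ae_ae hae] with ω hω
    rw [hI _ hω fun y => y.2, hI _ hω fun y => y.2 * y.1]
    congr 2
    rw [Finset.mul_sum]
    refine Finset.sum_congr rfl fun i _ => ?_
    simp only [Pi.smul_apply, Pi.mul_apply, smul_eq_mul]
    ring
  · congr 1
    refine lintegral_congr_ae ?_
    filter_upwards [hφ.ae_ae hae] with ω hω
    rw [hI _ hω fun y => y.1]

/-! ### Existence of the mean -/

/-- Simple functions converging pointwise to the identity of `ℝ`. -/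
def approxId (k : ℕ) : SimpleFunc ℝ ℝ := SimpleFunc.approxOn id measurable_id univ 0 (mem_univ 0) k

/-- The factor 2 is that of the general bound for `SimpleFunc.approxOn`; it is the source of every
`2 * |x|` below. -/
lemma abs_approxId_le (k : ℕ) (x : ℝ) : |approxId k x| ≤ 2 * |x| := by
  have := SimpleFunc.norm_approxOn_zero_le measurable_id (mem_univ (0 : ℝ)) x k
  simp only [id, Real.norm_eq_abs] at this
  rw [two_mul]
  exact this

lemma tendsto_approxId (x : ℝ) : Tendsto (fun k => approxId k x) atTop (𝓝 x) :=
  SimpleFunc.tendsto_approxOn measurable_id (mem_univ (0 : ℝ)) (by simp)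

/-- A bound for the probability that the mean exists. -/
lemma IsDirichletProcess.le_measure_lintegral_lt_top (hφ : IsDirichletProcess α P φ)
    [IsProbabilityMeasure P] [IsFiniteMeasure α] (hα : α ≠ 0) {c : ℝ} (hc : 0 < c)
    (hlog : Integrable (fun x => Real.log (1 + c * (2 * |x|))) α) :
    ENNReal.ofReal (Real.exp (-∫ x, Real.log (1 + c * (2 * |x|)) ∂α)) ≤
      P {ω | ∫⁻ x, ‖x‖ₑ ∂(φ ω : Measure ℝ) < ⊤} := by
  have ha : 0 < α.real univ :=
    ENNReal.toReal_pos (Measure.measure_univ_ne_zero.2 hα) (measure_ne_top _ _)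
  let τ : ℕ → SimpleFunc ℝ ℝ := fun k => (approxId k).map fun y => 1 + c * |y|
  have hτ : ∀ k x, τ k x = 1 + c * |approxId k x| := fun k x => rfl
  have hτ1 : ∀ k x, 1 ≤ τ k x := fun k x => by
    rw [hτ]
    have := mul_nonneg hc.le (abs_nonneg (approxId k x))
    linarith
  let D : ℕ → Ω → ENNReal := fun k ω =>
    ENNReal.ofReal ((∫ x, τ k x ∂(φ ω : Measure ℝ)) ^ (-α.real univ))
  have hD1 : ∀ k ω, D k ω ≤ 1 := fun k ω => by
    refine ENNReal.ofReal_le_one.2 (Real.rpow_le_one_of_one_le_of_nonpos ?_ (by linarith))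
    calc (1 : ℝ) = ∫ x, (1 : ℝ) ∂(φ ω : Measure ℝ) := by simp
      _ ≤ _ := integral_mono (integrable_const _) ((τ k).integrable_of_isFiniteMeasure) (hτ1 k)
  have hDm : ∀ k, Measurable (D k) := fun k => by
    have := (measurable_integral (τ k).measurable).comp hφ.measurable
    simp only [Function.comp_def] at this
    fun_prop
  have hmS : MeasurableSet {ω | ∫⁻ x, ‖x‖ₑ ∂(φ ω : Measure ℝ) < ⊤} :=
    measurableSet_lt (((Measure.measurable_lintegral measurable_enorm).comp
      measurable_subtype_coe).comp hφ.measurable) measurable_const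
  have hlow : ∀ k, ENNReal.ofReal (Real.exp (-∫ x, Real.log (1 + c * (2 * |x|)) ∂α)) ≤
      ∫⁻ ω, D k ω ∂P := fun k => by
    have h := hφ.lintegral_tilt_simple hα 0 (τ k) (fun x => one_pos.trans_le (hτ1 k x))
      (f := fun _ => 1) measurable_const
    simp only [one_mul, lintegral_const, measure_univ, mul_one] at h
    rw [h]
    refine ENNReal.ofReal_le_ofReal (Real.exp_le_exp.2 (neg_le_neg (integral_mono ?_ hlog ?_)))
    · exact ((τ k).map Real.log).integrable_of_isFiniteMeasure
    · intro x
      refine Real.log_le_log (one_pos.trans_le (hτ1 k x)) ?_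
      rw [hτ]
      have := mul_le_mul_of_nonneg_left (abs_approxId_le k x) hc.le
      linarith
  -- Since `τ k ≥ 1`, always `D k ≤ 1`; where `∫ |x| dφ` is infinite, Fatou's lemma sends `∫ τ k dφ`
  -- to infinity and its negative power to 0.
  have hlim : ∀ ω, limsup (fun k => D k ω) atTop ≤
      {ω | ∫⁻ x, ‖x‖ₑ ∂(φ ω : Measure ℝ) < ⊤}.indicator 1 ω := by
    intro ω
    by_cases hω : ∫⁻ x, ‖x‖ₑ ∂(φ ω : Measure ℝ) < ⊤
    · rw [indicator_of_mem (by simpa using hω)]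
      exact limsup_le_of_le (h := Eventually.of_forall fun k => hD1 k ω)
    · rw [indicator_of_notMem (by simpa using hω)]
      have htop : ∫⁻ x, ‖x‖ₑ ∂(φ ω : Measure ℝ) = ⊤ := not_lt_top_iff.1 hω
      have hfatou : Tendsto (fun k => ∫⁻ x, ‖approxId k x‖ₑ ∂(φ ω : Measure ℝ)) atTop (𝓝 ⊤) := by
        refine tendsto_of_le_liminf_of_limsup_le ?_ le_top
        rw [← htop]
        calc ∫⁻ x, ‖x‖ₑ ∂(φ ω : Measure ℝ)
            = ∫⁻ x, liminf (fun k => ‖approxId k x‖ₑ) atTop ∂(φ ω : Measure ℝ) :=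
              lintegral_congr fun x => (tendsto_approxId x).enorm.liminf_eq.symm
          _ ≤ _ := lintegral_liminf_le fun k => (approxId k).measurable.enorm
      have hDeq : ∀ k, D k ω = (1 + ENNReal.ofReal c *
          ∫⁻ x, ‖approxId k x‖ₑ ∂(φ ω : Measure ℝ)) ^ (-α.real univ) := by
        intro k
        have hpos : 0 < ∫ x, τ k x ∂(φ ω : Measure ℝ) := by
          calc (0 : ℝ) < 1 := one_pos
            _ = ∫ x, (1 : ℝ) ∂(φ ω : Measure ℝ) := by simp
            _ ≤ _ := integral_mono (integrable_const _)
              ((τ k).integrable_of_isFiniteMeasure) (hτ1 k)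
        simp only [D]
        rw [← ENNReal.ofReal_rpow_of_pos hpos, ofReal_integral_eq_lintegral_ofReal
          ((τ k).integrable_of_isFiniteMeasure)
          (Eventually.of_forall fun x => zero_le_one.trans (hτ1 k x))]
        congr 1
        have h1 : ∀ x, ENNReal.ofReal (τ k x) = 1 + ENNReal.ofReal c * ‖approxId k x‖ₑ :=
          fun x => by
            rw [hτ, ENNReal.ofReal_add zero_le_one (by positivity), ENNReal.ofReal_mul hc.le,
              ENNReal.ofReal_one, Real.enorm_eq_ofReal_abs]
        simp_rw [h1]
        rw [lintegral_add_left measurable_const,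
          lintegral_const_mul _ (approxId k).measurable.enorm]
        simp
      have hD0 : Tendsto (fun k => D k ω) atTop (𝓝 0) := by
        simp_rw [hDeq]
        have h2 := (ENNReal.continuous_rpow_const (y := -α.real univ)).tendsto ⊤
        rw [ENNReal.top_rpow_of_neg (by linarith)] at h2
        refine h2.comp ?_
        have h3 := ENNReal.Tendsto.const_mul (a := ENNReal.ofReal c) hfatou
          (Or.inl ENNReal.top_ne_zero)
        rw [ENNReal.mul_top (by simpa using hc)] at h3
        simpa using h3.const_add (1 : ENNReal)
      exact hD0.limsup_eq.le
  calc ENNReal.ofReal (Real.exp (-∫ x, Real.log (1 + c * (2 * |x|)) ∂α))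
      ≤ limsup (fun k => ∫⁻ ω, D k ω ∂P) atTop :=
        le_limsup_of_frequently_le (Frequently.of_forall hlow)
    _ ≤ ∫⁻ ω, limsup (fun k => D k ω) atTop ∂P :=
        -- Reverse Fatou, with the constant majorant 1.
        limsup_lintegral_le (g := 1) hDm (fun k => Eventually.of_forall (hD1 k)) (by simp)
    _ ≤ ∫⁻ ω, {ω | ∫⁻ x, ‖x‖ₑ ∂(φ ω : Measure ℝ) < ⊤}.indicator 1 ω ∂P := lintegral_mono hlim
    _ = _ := lintegral_indicator_one hmS

/-- The mean of a Dirichlet process exists almost surely. -/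
lemma IsDirichletProcess.ae_integrable (hφ : IsDirichletProcess α P φ)
    [IsProbabilityMeasure P] [IsFiniteMeasure α] (hα : α ≠ 0)
    (hlog : Integrable (fun x => Real.log (1 + |x|)) α) :
    ∀ᵐ ω ∂P, Integrable (fun x : ℝ => x) (φ ω : Measure ℝ) := by
  have hbound : ∀ c : ℝ, 0 < c → c ≤ 1 → ∀ x : ℝ,
      ‖Real.log (1 + c * (2 * |x|))‖ ≤ 2 * Real.log (1 + |x|) := by
    intro c hc0 hc1 x
    have hx := abs_nonneg x
    have h0 : 0 ≤ c * (2 * |x|) := by positivity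
    rw [Real.norm_of_nonneg (Real.log_nonneg (by linarith)),
      ← Real.log_rpow (by positivity)]
    -- For `c ≤ 1` one has `1 + 2c|x| ≤ (1 + |x|)²`.
    refine Real.log_le_log (by linarith) ?_
    rw [Real.rpow_two]
    nlinarith
  have hmeas : ∀ c : ℝ, AEStronglyMeasurable (fun x => Real.log (1 + c * (2 * |x|))) α := fun c =>
    (Measurable.log (by fun_prop)).aestronglyMeasurable
  have hint : ∀ c : ℝ, 0 < c → c ≤ 1 →
      Integrable (fun x => Real.log (1 + c * (2 * |x|))) α := fun c h0 h1 =>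
    (hlog.const_mul 2).mono' (hmeas c) (Eventually.of_forall (hbound c h0 h1))
  have hlim : Tendsto (fun c : ℝ => ∫ x, Real.log (1 + c * (2 * |x|)) ∂α) (𝓝[>] 0) (𝓝 0) := by
    have h : Tendsto (fun c : ℝ => ∫ x, Real.log (1 + c * (2 * |x|)) ∂α) (𝓝[>] 0)
        (𝓝 (∫ _, (0 : ℝ) ∂α)) := by
      refine tendsto_integral_filter_of_dominated_convergence (fun x => 2 * Real.log (1 + |x|))
        (Eventually.of_forall hmeas) ?_ (hlog.const_mul 2)
        (Eventually.of_forall fun x => ?_)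
      · filter_upwards [Ioc_mem_nhdsGT (zero_lt_one (α := ℝ))] with c hc
        exact Eventually.of_forall (hbound c hc.1 hc.2)
      · have : ContinuousAt (fun c : ℝ => Real.log (1 + c * (2 * |x|))) 0 :=
          ContinuousAt.log (by fun_prop) (by simp)
        have h2 := this.tendsto
        simp only [zero_mul, add_zero, Real.log_one] at h2
        exact h2.mono_left nhdsWithin_le_nhds
    simpa using h
  have h1 : 1 ≤ P {ω | ∫⁻ x, ‖x‖ₑ ∂(φ ω : Measure ℝ) < ⊤} := by
    have h2 : Tendsto (fun c : ℝ => ENNReal.ofReal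
        (Real.exp (-∫ x, Real.log (1 + c * (2 * |x|)) ∂α))) (𝓝[>] 0) (𝓝 1) := by
      have := ENNReal.tendsto_ofReal ((Real.continuous_exp.tendsto _).comp hlim.neg)
      simpa using this
    refine le_of_tendsto h2 ?_
    filter_upwards [Ioc_mem_nhdsGT (zero_lt_one (α := ℝ))] with c hc
    exact hφ.le_measure_lintegral_lt_top hα hc.1 (hint c hc.1 hc.2)
  have hmS : MeasurableSet {ω | ∫⁻ x, ‖x‖ₑ ∂(φ ω : Measure ℝ) < ⊤} :=
    measurableSet_lt (((Measure.measurable_lintegral measurable_enorm).comp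
      measurable_subtype_coe).comp hφ.measurable) measurable_const
  have h3 := (mem_ae_iff_prob_eq_one₀ hmS.nullMeasurableSet).2 (le_antisymm prob_le_one h1)
  filter_upwards [h3] with ω hω
  exact ⟨by fun_prop, hω⟩

/-! ### Tilting identity for the mean itself -/

/-- Tilting by a positive simple function, in terms of the distribution of the mean. -/
lemma IsDirichletProcess.lintegral_tilt_mean (hφ : IsDirichletProcess α P φ)
    [IsProbabilityMeasure P] [IsFiniteMeasure α] (hα : α ≠ 0)
    (hint : ∀ᵐ ω ∂P, Integrable (fun x : ℝ => x) (φ ω : Measure ℝ))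
    (τ : SimpleFunc ℝ ℝ) (hτ : ∀ x, 0 < τ x) {f : ℝ → ENNReal} (hf : Measurable f) :
    ∫⁻ ω, f ((∫ x, τ x ∂(φ ω : Measure ℝ))⁻¹ * ∫ x, τ x * x ∂(φ ω : Measure ℝ)) *
        ENNReal.ofReal ((∫ x, τ x ∂(φ ω : Measure ℝ)) ^ (-α.real univ)) ∂P =
      ENNReal.ofReal (Real.exp (-∫ x, Real.log (τ x) ∂α)) *
        ∫⁻ ω, f (∫ x, x ∂(φ ω : Measure ℝ)) ∂P := by
  have hI : ∀ {h : ℝ → ℝ}, Measurable h → Measurable fun ω => ∫ x, h x ∂(φ ω : Measure ℝ) :=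
    fun hh => (measurable_integral hh).comp hφ.measurable
  let w : Ω → ENNReal := fun ω =>
    ENNReal.ofReal ((∫ x, τ x ∂(φ ω : Measure ℝ)) ^ (-α.real univ))
  let T : Ω → ℝ := fun ω =>
    (∫ x, τ x ∂(φ ω : Measure ℝ))⁻¹ * ∫ x, τ x * x ∂(φ ω : Measure ℝ)
  let C : ENNReal := ENNReal.ofReal (Real.exp (-∫ x, Real.log (τ x) ∂α))
  have hτm := τ.measurable
  have hwm : Measurable w := by
    have := hI hτm
    fun_prop
  have hT : Measurable T :=
    (hI hτm).inv.mul (hI (h := fun x => τ x * x) (hτm.mul measurable_id))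
  have hm : Measurable fun ω => ∫ x, x ∂(φ ω : Measure ℝ) := hI measurable_id
  have hw : ∫⁻ ω, w ω ∂P = C := by
    simpa using hφ.lintegral_tilt_simple hα 0 τ hτ (f := fun _ => 1) measurable_const
  have hwd : ∀ {F : ℝ → ENNReal}, Measurable F →
      ∫⁻ ω, F (T ω) ∂P.withDensity w = ∫⁻ ω, F (T ω) * w ω ∂P := fun {F} hF => by
    rw [lintegral_withDensity_eq_lintegral_mul _ hwm (g := fun ω => F (T ω)) (hF.comp hT)]
    exact lintegral_congr fun ω => mul_comm _ _
  have : IsFiniteMeasure (C • P.map fun ω => ∫ x, x ∂(φ ω : Measure ℝ)) :=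
    Measure.smul_finite _ ENNReal.ofReal_ne_top
  -- For bounded continuous `f` the simple approximations of the identity pass to the limit.
  -- Equality of the two finite measures then covers every measurable `f`, in particular indicators.
  have hmeas : C • P.map (fun ω => ∫ x, x ∂(φ ω : Measure ℝ)) = (P.withDensity w).map T := by
    refine ext_of_forall_lintegral_eq_of_IsFiniteMeasure fun f => ?_
    have hfm : Measurable fun x => (f x : ENNReal) := by fun_prop
    have hfc : Continuous fun x => (f x : ENNReal) := by fun_prop
    have hfb : ∀ x, (f x : ENNReal) ≤ nndist f 0 := fun x =>
      ENNReal.coe_le_coe.2 (BoundedContinuousFunction.NNReal.upper_bound f x)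
    rw [lintegral_smul_measure, lintegral_map hfm hm, lintegral_map hfm hT,
      hwd hfm, smul_eq_mul]
    have hgm : ∀ k, Measurable fun ω => ∫ x, approxId k x ∂(φ ω : Measure ℝ) := fun k =>
      hI (approxId k).measurable
    have hgτm : ∀ k, Measurable fun ω => (∫ x, τ x ∂(φ ω : Measure ℝ))⁻¹ *
        ∫ x, τ x * approxId k x ∂(φ ω : Measure ℝ) := fun k =>
      (hI hτm).inv.mul (hI (h := fun x => τ x * approxId k x) (hτm.mul (approxId k).measurable))
    have hL : Tendsto (fun k => C * ∫⁻ ω, f (∫ x, approxId k x ∂(φ ω : Measure ℝ)) ∂P) atTop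
        (𝓝 (C * ∫⁻ ω, f (∫ x, x ∂(φ ω : Measure ℝ)) ∂P)) := by
      refine ENNReal.Tendsto.const_mul ?_ (Or.inr ENNReal.ofReal_ne_top)
      refine tendsto_lintegral_of_dominated_convergence (fun _ => nndist f 0)
        (fun k => hfm.comp (hgm k)) (fun k => Eventually.of_forall fun ω => hfb _)
        (by simp) ?_
      filter_upwards [hint] with ω hω
      refine (hfc.tendsto _).comp ?_
      refine tendsto_integral_of_dominated_convergence (fun x => 2 * |x|)
        (fun k => (approxId k).measurable.aestronglyMeasurable) (hω.abs.const_mul 2)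
        (fun k => Eventually.of_forall (abs_approxId_le k))
        (Eventually.of_forall tendsto_approxId)
    have hR : Tendsto (fun k => ∫⁻ ω, f ((∫ x, τ x ∂(φ ω : Measure ℝ))⁻¹ *
        ∫ x, τ x * approxId k x ∂(φ ω : Measure ℝ)) * w ω ∂P) atTop
        (𝓝 (∫⁻ ω, f (T ω) * w ω ∂P)) := by
      refine tendsto_lintegral_of_dominated_convergence (fun ω => nndist f 0 * w ω)
        (fun k => (hfm.comp (hgτm k)).mul hwm)
        (fun k => Eventually.of_forall fun ω => mul_le_mul_left (hfb _) _) ?_ ?_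
      · rw [lintegral_const_mul _ hwm, hw]
        exact ENNReal.mul_ne_top ENNReal.coe_ne_top ENNReal.ofReal_ne_top
      · filter_upwards [hint] with ω hω
        refine ENNReal.Tendsto.mul_const ((hfc.tendsto _).comp (Tendsto.const_mul _ ?_))
          (Or.inr ENNReal.ofReal_ne_top)
        obtain ⟨M, hM⟩ := τ.exists_forall_norm_le
        refine tendsto_integral_of_dominated_convergence (fun x => M * (2 * |x|))
          (fun k => (hτm.mul (approxId k).measurable).aestronglyMeasurable)
          ((hω.abs.const_mul 2).const_mul M) (fun k => Eventually.of_forall fun x => ?_)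
          (Eventually.of_forall fun x => (tendsto_approxId x).const_mul _)
        rw [norm_mul]
        exact mul_le_mul (hM x) (abs_approxId_le k x) (norm_nonneg _)
          ((norm_nonneg _).trans (hM x))
    have hLR := tendsto_nhds_unique hL (hR.congr fun k =>
      hφ.lintegral_tilt_simple hα (approxId k) τ hτ hfm)
    exact hLR
  have h := congrArg (fun ν : Measure ℝ => ∫⁻ x, f x ∂ν) hmeas
  simp only [lintegral_smul_measure, lintegral_map hf hm, lintegral_map hf hT, hwd hf,
    smul_eq_mul] at h
  exact h.symm

/-! ### Splitting the line at a threshold -/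

/-- A measure on `ℝ` that is not carried by a single point charges both sides of some threshold. -/
lemma exists_measure_Iic_pos_and_Ioi_pos {α : Measure ℝ} (h : ∀ x : ℝ, α {x} < α univ) :
    ∃ t, 0 < α (Iic t) ∧ 0 < α (Ioi t) := by
  have hα : α ≠ 0 := fun h0 => by simpa [h0] using h 0
  obtain ⟨x, hx⟩ := Measure.nonempty_support hα
  -- The complement of the support is null, so a one-point support would carry all the mass; `t`
  -- separates two support points.
  obtain ⟨y, hy, hyx⟩ : ∃ y ∈ α.support, y ≠ x := by
    by_contra! hc
    refine (h x).ne (le_antisymm (measure_mono (subset_univ _)) ?_)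
    calc α univ ≤ α ({x} ∪ α.supportᶜ) := measure_mono fun z _ => by
          by_cases hz : z ∈ α.support
          · exact Or.inl (hc z hz)
          · exact Or.inr hz
      _ ≤ α {x} + α α.supportᶜ := measure_union_le _ _
      _ = α {x} := by rw [Measure.measure_compl_support, add_zero]
  rw [Measure.mem_support_iff_forall] at hx hy
  rcases lt_or_gt_of_ne hyx with hlt | hlt
  · obtain ⟨t, h1, h2⟩ := exists_between hlt
    exact ⟨t, hy _ (Iic_mem_nhds h1), hx _ (Ioi_mem_nhds h2)⟩
  · obtain ⟨t, h1, h2⟩ := exists_between hlt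
    exact ⟨t, hx _ (Iic_mem_nhds h1), hy _ (Ioi_mem_nhds h2)⟩

/-- A nondegenerate Möbius transformation pulls null sets back to null sets. -/
lemma volume_moebius_preimage_eq_zero {p q D E : ℝ} (hD : 0 < D) (hE : 0 < E)
    (hdet : p * E < q * D) {N : Set ℝ} (hN : volume N = 0) :
    volume {s : ℝ | 0 < s ∧ (s * D + E)⁻¹ * (s * p + q) ∈ N} = 0 := by
  have hN' : volume (N ∩ {m | D * m - p ≠ 0}) = 0 := measure_mono_null inter_subset_left hN
  -- The set lies in the image of `N`, minus the pole, under the inverse Möbius map; a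
  -- differentiable map sends null sets to null sets.
  refine measure_mono_null ?_ (addHaar_image_eq_zero_of_differentiableOn_of_addHaar_eq_zero volume
    (f := fun m => (q - E * m) / (D * m - p)) (fun m hm => ?_) hN')
  · rintro s ⟨hs, hsN⟩
    have hden : 0 < s * D + E := by positivity
    have h1 : D * ((s * D + E)⁻¹ * (s * p + q)) - p = (q * D - p * E) / (s * D + E) := by
      field_simp
      ring
    have h2 : q - E * ((s * D + E)⁻¹ * (s * p + q)) = s * ((q * D - p * E) / (s * D + E)) := by
      field_simp
      ring
    have h3 : (q * D - p * E) / (s * D + E) ≠ 0 := (div_pos (by linarith) hden).ne'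
    refine ⟨_, ⟨hsN, ?_⟩, ?_⟩
    · simpa only [mem_ofPred_eq, h1] using h3
    · simp only [h1, h2]
      exact mul_div_cancel_right₀ s h3
  · refine DifferentiableAt.differentiableWithinAt ?_
    exact DifferentiableAt.div (by fun_prop) (by fun_prop) hm.2

/-- The barycentre of the part of `μ` left of `t` is smaller than that of the part right of `t`. -/
lemma setIntegral_Iic_mul_lt {μ : Measure ℝ} [IsFiniteMeasure μ] {t : ℝ}
    (hint : Integrable (fun x : ℝ => x) μ) (h1 : 0 < μ.real (Iic t)) (h2 : 0 < μ.real (Ioi t)) :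
    (∫ x in Iic t, x ∂μ) * μ.real (Ioi t) < (∫ x in Ioi t, x ∂μ) * μ.real (Iic t) := by
  have hl : ∫ x in Iic t, x ∂μ ≤ t * μ.real (Iic t) := by
    calc ∫ x in Iic t, x ∂μ ≤ ∫ x in Iic t, t ∂μ :=
          setIntegral_mono_on hint.integrableOn (integrable_const _) measurableSet_Iic
            fun x hx => hx
      _ = t * μ.real (Iic t) := by simp [mul_comm]
  have hr : t * μ.real (Ioi t) < ∫ x in Ioi t, x ∂μ := by
    have h3 : 0 < ∫ x in Ioi t, (x - t) ∂μ := by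
      rw [setIntegral_pos_iff_support_of_nonneg_ae]
      · refine (ENNReal.toReal_pos_iff.1 h2).1.trans_le (measure_mono fun x hx => ⟨?_, hx⟩)
        simpa [sub_eq_zero] using (ne_of_gt hx)
      · filter_upwards [ae_restrict_mem measurableSet_Ioi] with x hx
        simpa using (le_of_lt hx)
      · exact (hint.sub (integrable_const t)).integrableOn
    rw [integral_sub hint.integrableOn (integrable_const _)] at h3
    simp only [setIntegral_const, smul_eq_mul] at h3
    linarith
  nlinarith

/-! ### Absolute continuity -/

/-- The distribution of the mean of a Dirichlet process whose parameter is not carried by a single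
point is absolutely continuous. -/
lemma IsDirichletProcess.map_mean_absolutelyContinuous
    (hφ : IsDirichletProcess α P φ) [IsProbabilityMeasure P] [IsFiniteMeasure α]
    (hatom : ∀ x : ℝ, α {x} < α univ)
    (hint : ∀ᵐ ω ∂P, Integrable (fun x : ℝ => x) (φ ω : Measure ℝ)) :
    P.map (fun ω => mean (φ ω)) ≪ (volume : Measure ℝ) := by
  have hα0 : α ≠ 0 := fun h0 => by simpa [h0] using hatom 0
  refine Measure.AbsolutelyContinuous.mk fun N hNm hN => ?_
  obtain ⟨t, ht1, ht2⟩ := exists_measure_Iic_pos_and_Ioi_pos (α := α) hatom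
  have hmean : Measurable fun ω => mean (φ ω) := measurable_mean.comp hφ.measurable
  rw [Measure.map_apply hmean hNm]
  have hI : ∀ {h : ℝ → ℝ}, Measurable h → Measurable fun ω => ∫ x, h x ∂(φ ω : Measure ℝ) :=
    fun hh => (measurable_integral hh).comp hφ.measurable
  -- Tilting by `s` on the left half-line turns the mean into `(s p + q) / (s D + E)`.
  let τ : ℝ → SimpleFunc ℝ ℝ := fun s =>
    SimpleFunc.piecewise (Iic t) measurableSet_Iic (SimpleFunc.const ℝ s) (SimpleFunc.const ℝ 1)
  have hτ : ∀ s x, τ s x = s * (Iic t).indicator 1 x + (Ioi t).indicator 1 x := fun s x => by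
    by_cases hx : x ≤ t <;> simp [τ, hx, not_lt.2, lt_of_not_ge]
  have hτpos : ∀ s, 0 < s → ∀ x, 0 < τ s x := fun s hs x => by
    by_cases hx : x ≤ t <;> simp [τ, hx, hs]
  let D : Ω → ℝ := fun ω => (φ ω : Measure ℝ).real (Iic t)
  let E : Ω → ℝ := fun ω => (φ ω : Measure ℝ).real (Ioi t)
  let p : Ω → ℝ := fun ω => ∫ x in Iic t, x ∂(φ ω : Measure ℝ)
  let q : Ω → ℝ := fun ω => ∫ x in Ioi t, x ∂(φ ω : Measure ℝ)
  have hDm : Measurable D := (measurable_measureReal measurableSet_Iic).comp hφ.measurable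
  have hEm : Measurable E := (measurable_measureReal measurableSet_Ioi).comp hφ.measurable
  have hpm : Measurable p := by
    simp only [p, ← integral_indicator measurableSet_Iic]
    exact hI (measurable_id.indicator measurableSet_Iic)
  have hqm : Measurable q := by
    simp only [q, ← integral_indicator measurableSet_Ioi]
    exact hI (measurable_id.indicator measurableSet_Ioi)
  let c : ℝ → Fin 2 := fun x => if x ≤ t then 0 else 1
  have hc : Measurable c := Measurable.ite measurableSet_Iic measurable_const measurable_const
  have hc0 : c ⁻¹' {0} = Iic t := by
    ext x
    by_cases hx : x ≤ t <;> simp [c, hx]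
  have hc1 : c ⁻¹' {1} = Ioi t := by
    ext x
    by_cases hx : x ≤ t <;> simp [c, hx, not_lt.2, lt_of_not_ge]
  have hpos := hφ.ae_pos hc (by simp [Fin.forall_fin_two, hc0, hc1, ht1, ht2])
  have hmass_tilt : ∀ s ω, ∫ x, τ s x ∂(φ ω : Measure ℝ) = s * D ω + E ω := fun s ω => by
    simp_rw [hτ]
    rw [integral_add, integral_const_mul, integral_indicator_one measurableSet_Iic,
      integral_indicator_one measurableSet_Ioi]
    · exact ((integrable_const (1 : ℝ)).indicator measurableSet_Iic).const_mul s
    · exact (integrable_const (1 : ℝ)).indicator measurableSet_Ioi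
  have hmean_tilt : ∀ᵐ ω ∂P, ∀ s, ∫ x, τ s x * x ∂(φ ω : Measure ℝ) = s * p ω + q ω := by
    filter_upwards [hint] with ω hω s
    have h : ∀ x, τ s x * x = s * (Iic t).indicator (fun x => x) x +
        (Ioi t).indicator (fun x => x) x := fun x => by
      rw [hτ]
      by_cases hx : x ≤ t <;> simp [hx, not_lt.2, lt_of_not_ge]
    simp_rw [h]
    rw [integral_add, integral_const_mul, integral_indicator measurableSet_Iic,
      integral_indicator measurableSet_Ioi]
    · exact (hω.indicator measurableSet_Iic).const_mul s
    · exact hω.indicator measurableSet_Ioi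
  let G : ℝ → Ω → ENNReal := fun s ω =>
    N.indicator 1 ((s * D ω + E ω)⁻¹ * (s * p ω + q ω)) *
      ENNReal.ofReal ((s * D ω + E ω) ^ (-α.real univ))
  have hGm : Measurable (Function.uncurry G) := by
    have h1 : Measurable (N.indicator (1 : ℝ → ENNReal)) := measurable_one.indicator hNm
    simp only [Function.uncurry_def, G]
    refine (h1.comp ?_).mul ?_ <;> fun_prop
  have htilt : ∀ s, 0 < s → ∫⁻ ω, G s ω ∂P =
      ENNReal.ofReal (Real.exp (-∫ x, Real.log (τ s x) ∂α)) *
        P ((fun ω => mean (φ ω)) ⁻¹' N) := fun s hs => by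
    have h1 : Measurable (N.indicator (1 : ℝ → ENNReal)) := measurable_one.indicator hNm
    have h2 := hφ.lintegral_tilt_mean hα0 hint (τ s) (hτpos s hs) h1
    rw [← lintegral_indicator_one (hmean hNm)]
    refine Eq.trans (lintegral_congr_ae ?_) h2
    filter_upwards [hmean_tilt] with ω hω
    rw [hω, hmass_tilt]
  -- After exchanging the integrals, each fixed realization sees `N` only for a null set of `s`.
  have hzero : ∫⁻ s in Ioi (0 : ℝ), ∫⁻ ω, G s ω ∂P = 0 := by
    rw [lintegral_lintegral_swap hGm.aemeasurable]
    refine lintegral_eq_zero_of_ae_eq_zero ?_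
    filter_upwards [hint, hpos] with ω hω hω0
    have hD : 0 < D ω := by have h := hω0 0; rwa [hc0] at h
    have hE : 0 < E ω := by have h := hω0 1; rwa [hc1] at h
    refine lintegral_eq_zero_of_ae_eq_zero ?_
    have h3 := volume_moebius_preimage_eq_zero hD hE (setIntegral_Iic_mul_lt hω hD hE) hN
    filter_upwards [ae_restrict_mem measurableSet_Ioi,
      ae_restrict_of_ae (measure_eq_zero_iff_ae_notMem.1 h3)] with s hs hsN
    have hsN : (s * D ω + E ω)⁻¹ * (s * p ω + q ω) ∉ N := fun h => hsN ⟨hs, h⟩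
    simp [G, hsN]
  rw [lintegral_eq_zero_iff (f := fun s => ∫⁻ ω, G s ω ∂P) hGm.lintegral_prod_right'] at hzero
  have : (ae (volume.restrict (Ioi (0 : ℝ)))).NeBot := by
    rw [ae_neBot, Ne, Measure.restrict_eq_zero]
    simp
  -- A single good `s > 0` suffices, as the exponential factor in `htilt` is positive.
  obtain ⟨s, hs, hs0⟩ := (hzero.and (ae_restrict_mem measurableSet_Ioi)).exists
  replace hs : ∫⁻ ω, G s ω ∂P = 0 := hs
  rw [htilt s hs0, mul_eq_zero] at hs
  exact hs.resolve_left (by simpa using Real.exp_pos _)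

end DirichletMean

end

theorem proposition2 (a : ℝ) (ha : 0 < a) (α : Measure ℝ) (hα : α ∈ DirichletMean.classF a)
    (hatom : ∀ x : ℝ, α {x} < ENNReal.ofReal a)
    {Ω : Type*} [MeasurableSpace Ω] (P : Measure Ω) [IsProbabilityMeasure P]
    (φ : Ω → ProbabilityMeasure ℝ) (hφ : DirichletMean.IsDirichletProcess α P φ) :
    (∀ᵐ ω ∂P, Integrable (fun x : ℝ => x) (φ ω : Measure ℝ)) ∧
      P.map (fun ω => DirichletMean.mean (φ ω)) ≪ (volume : Measure ℝ) := by
  obtain ⟨hmass, hlog⟩ := hα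
  have : IsFiniteMeasure α := ⟨by rw [hmass]; exact ENNReal.ofReal_lt_top⟩
  have hα0 : α ≠ 0 := by
    rintro rfl
    simp at hmass
    linarith
  have hint := hφ.ae_integrable hα0 hlog
  exact ⟨hint, hφ.map_mean_absolutelyContinuous (by rwa [hmass]) hint⟩
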